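/- Let $n\ge 1$, $A\in\mathbb R^{n\times n}$, $B\in\mathbb R^{n\times p}$, $C\in\mathbb R^{m\times n}$, and let $R\in\mathbb R^{p\times p}$ be symmetric positive definite. Assume that $(A,B)$ is controllable, i.e. $[B,AB,\dots,A^{n-1}B]$ has rank $n$, and that $(A,C)$ is observable, i.e. $\mathrm{col}(C,CA,\dots,CA^{n-1})$ has rank $n$. Let $\mathbb S^n_+$ be the cone of real symmetric positive semidefinite $n\times n$ matrices, with the order $X\preceq Y\iff Y-X\in\mathbb S^n_+$. For $\alpha>0$ and $X\in\mathbb S_+^n\setminus\{0\}$ put $$F_\alpha(X)=A^\top S_\alpha(X)A+\alpha\,\mathrm{tr}(X)\,C^\top C,\qquad S_\alpha(X)=X-XB\bigl(\alpha\,\mathrm{tr}(X)R+B^\top XB\bigr)^{-1}B^\top X,$$ and $F_\alpha(0)=0$. Let $\rho(F_\alpha)=\sup_{X\in\mathbb S^n_+}\limsup_{k\to\infty}\|F_\alpha^k(X)\|^{1/k}$ be its cone spectral radius ($\|\cdot\|$ is the Frobenius norm). For $X,Y\in\mathbb S^n_+\setminus\{0\}$ let $d_{\mathcal H}(X,Y)=\ln\frac{M(X/Y)}{m(X/Y)}\in[0,\infty]$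 be the Hilbert metric, where $M(X/Y)=\inf\{\lambda: X\preceq\lambda Y\}$ (with $\inf\emptyset=\infty$) and $m(X/Y)=\sup\{\mu:\mu Y\preceq X\}$, and $d_{\mathcal H}(X,Y)=\infty$ if $M(X/Y)=\infty$ or $m(X/Y)=0$. Then: 1. The discrete-time algebraic Riccati equation $$P=A^\top PA-A^\top PB(R+B^\top PB)^{-1}B^\top PA+C^\top C$$ has exactly one positive definite solution $P$. 2. There is an $\alpha>0$ with $\rho(F_\alpha)=1$. 3. For every $\alpha>0$ with $\rho(F_\alpha)=1$: there is a positive definite $X_*$ with $F_\alpha(X_*)=\rho(F_\alpha)X_*=X_*$; it is unique up to positive scaling among the elements of $\mathbb S_+^n\setminus\{0\}$ with this property; and the solution in 1 is $P=\dfrac{X_*}{\alpha\,\mathrm{tr}(X_*)}$. Moreover, for every $X_0\in\mathbb S^n_+\setminus\{0\}$ the iterates $X_{k+1}=F_\alpha(X_k)$ satisfy $d_{\mathcal H}(X_k,P)\to0$ as $k\to\infty$. -/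

import Mathlib

open Filter Topology
open scoped ENNReal NNReal Matrix

namespace PosRiccati

noncomputable section

/-! Controllability and observability of matrix pairs -/

/-- The controllability matrix `[B, A B, …, A ^ (n - 1) B]`; the column with index `(k, j)` is the
`j`-th column of `A ^ k * B`. -/
def controllabilityMatrix {n p : ℕ} (A : Matrix (Fin n) (Fin n) ℝ) (B : Matrix (Fin n) (Fin p) ℝ) :
    Matrix (Fin n) (Fin n × Fin p) ℝ :=
  Matrix.of fun i q => (A ^ (q.1 : ℕ) * B) i q.2

/-- The observability matrix `col(C, C A, …, C A ^ (n - 1))`; the row with index `(k, i)` is the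
`i`-th row of `C * A ^ k`. -/
def observabilityMatrix {n m : ℕ} (A : Matrix (Fin n) (Fin n) ℝ) (C : Matrix (Fin m) (Fin n) ℝ) :
    Matrix (Fin n × Fin m) (Fin n) ℝ :=
  Matrix.of fun q j => (C * A ^ (q.1 : ℕ)) q.2 j

def IsControllable {n p : ℕ} (A : Matrix (Fin n) (Fin n) ℝ) (B : Matrix (Fin n) (Fin p) ℝ) : Prop :=
  (controllabilityMatrix A B).rank = n

def IsObservable {n m : ℕ} (A : Matrix (Fin n) (Fin n) ℝ) (C : Matrix (Fin m) (Fin n) ℝ) : Prop :=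
  (observabilityMatrix A C).rank = n

/-! Cones: Hilbert metric, spectral radius, Perron–Frobenius eigenvectors -/

/-- The order induced by a cone `K`: `x ≤ y` when `y - x ∈ K`. -/
def ConeLE {V : Type*} [AddCommGroup V] (K : Set V) (x y : V) : Prop := y - x ∈ K

/-- `M(x/y) = inf {λ : x ≤ λ y}`, equal to `∞` if there is no such `λ`. For nonzero `x`, `y` in a
cone every such `λ` is positive, so that it is enough to let `λ` range over the reals `λ ≥ 0`. -/
def hilbertSup {V : Type*} [AddCommGroup V] [Module ℝ V] (K : Set V) (x y : V) : ℝ≥0∞ :=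
  ⨅ (l : ℝ≥0) (_ : ConeLE K x ((l : ℝ) • y)), (l : ℝ≥0∞)

/-- `m(x/y) = sup {μ : μ y ≤ x}`. For `x` in a cone `μ = 0` is admissible, so that it is enough to
let `μ` range over the reals `μ ≥ 0`. -/
def hilbertInf {V : Type*} [AddCommGroup V] [Module ℝ V] (K : Set V) (x y : V) : ℝ≥0∞ :=
  ⨆ (l : ℝ≥0) (_ : ConeLE K ((l : ℝ) • y) x), (l : ℝ≥0∞)

/-- The Hilbert metric `ln (M(x/y) / m(x/y))` of nonzero `x`, `y` in a closed cone, with values in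
`[0, ∞]`. There `M(x/y) > 0` and `m(x/y) < ∞`, so the quotient is never `0/0` or `∞/∞`, and it is
`∞` when `M(x/y) = ∞` or `m(x/y) = 0`. -/
def hilbertMetric {V : Type*} [AddCommGroup V] [Module ℝ V] (K : Set V) (x y : V) : EReal :=
  ENNReal.log (hilbertSup K x y / hilbertInf K x y)

/-- The cone spectral radius `sup_{x ∈ K} limsup_k ‖T ^ k x‖ ^ (1 / k)`, with values in `[0, ∞]`. -/
def coneSpectralRadius {V : Type*} [NormedAddCommGroup V] (K : Set V) (T : V → V) : ℝ≥0∞ :=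
  ⨆ x ∈ K, limsup (fun k : ℕ => ‖T^[k] x‖ₑ ^ (1 / (k : ℝ))) atTop

/-- The cone of real symmetric positive semidefinite `n × n` matrices. -/
def psdCone (n : ℕ) : Set (Matrix (Fin n) (Fin n) ℝ) := {X | X.PosSemidef}

section
open scoped Matrix.Norms.Frobenius

/-- The cone spectral radius on the positive semidefinite cone, for the Frobenius norm. -/
def psdSpectralRadius {n : ℕ} (T : Matrix (Fin n) (Fin n) ℝ → Matrix (Fin n) (Fin n) ℝ) : ℝ≥0∞ :=
  coneSpectralRadius (psdCone n) T

end

/-- `X` is a nonzero element of the positive semidefinite cone with `T X = ρ(T) X`, where the cone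
spectral radius `ρ(T)` is finite. -/
def IsPerronFrobeniusEigenvector {n : ℕ}
    (T : Matrix (Fin n) (Fin n) ℝ → Matrix (Fin n) (Fin n) ℝ) (X : Matrix (Fin n) (Fin n) ℝ) :
    Prop :=
  X ∈ psdCone n ∧ X ≠ 0 ∧ psdSpectralRadius T ≠ ∞ ∧ T X = (psdSpectralRadius T).toReal • X

/-! The discrete-time algebraic Riccati equation and its homogenization -/

/-- `P = Aᵀ P A - Aᵀ P B (R + Bᵀ P B)⁻¹ Bᵀ P A + Cᵀ C`. -/
def SolvesDARE {n m p : ℕ} (A : Matrix (Fin n) (Fin n) ℝ) (B : Matrix (Fin n) (Fin p) ℝ)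
    (C : Matrix (Fin m) (Fin n) ℝ) (R : Matrix (Fin p) (Fin p) ℝ)
    (P : Matrix (Fin n) (Fin n) ℝ) : Prop :=
  P = Aᵀ * P * A - Aᵀ * P * B * (R + Bᵀ * P * B)⁻¹ * Bᵀ * P * A + Cᵀ * C

/-- `S(X) = X - X B (α tr(X) R + Bᵀ X B)⁻¹ Bᵀ X`. For nonzero positive semidefinite `X`, positive
definite `R` and `α > 0` the inverted matrix is positive definite; at `X = 0` the value is `0`, which
is the continuous extension. -/
def homS {n p : ℕ} (B : Matrix (Fin n) (Fin p) ℝ) (R : Matrix (Fin p) (Fin p) ℝ) (α : ℝ)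
    (X : Matrix (Fin n) (Fin n) ℝ) : Matrix (Fin n) (Fin n) ℝ :=
  X - X * B * ((α * X.trace) • R + Bᵀ * X * B)⁻¹ * Bᵀ * X

/-- The homogenized Riccati map `F(X) = Aᵀ S(X) A + α tr(X) Cᵀ C`. -/
def homF {n m p : ℕ} (A : Matrix (Fin n) (Fin n) ℝ) (B : Matrix (Fin n) (Fin p) ℝ)
    (C : Matrix (Fin m) (Fin n) ℝ) (R : Matrix (Fin p) (Fin p) ℝ) (α : ℝ)
    (X : Matrix (Fin n) (Fin n) ℝ) : Matrix (Fin n) (Fin n) ℝ :=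
  Aᵀ * homS B R α X * A + (α * X.trace) • (Cᵀ * C)

end

end PosRiccati

/-! For a weight `t` on `R` and `Cᵀ C`, the quadratic form of `riccatiMap` at a state is the minimum
over controls of `stepCost`, which is linear in `(t, X)`. Hence the map is jointly homogeneous and
superadditive (`riccatiMap_add_le`). Putting `t = α tr X` gives a homogeneous, superadditive,
monotone `homF` on the cone, and a definite `P` solves the Riccati equation iff it is fixed by
`homF` with `α = 1 / tr P`.

Controllability gives a solution: value iteration from `0` increases and stays bounded, because each
state can be steered to `0` in `n` steps (`exists_riccatiMap_eq_self`). Observability gives strict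
positivity: `n + 1` steps send every `Z ≥ 0` above `δ tr(Z) P` with a uniform `δ`
(`exists_smul_le_iterate_homF`). This shrinks order intervals `[a P, b P]` geometrically, so orbits
converge to the ray of `P` and fixed points are unique up to scale (`exists_eventually_le`).

A definite fixed point forces spectral radius `1`. Conversely, if `α tr P` differs from `1`, then
`homF` moves `P` down or up by at least a multiple of `Cᵀ C`; after `n + 1` steps this defect is
definite and the radius lies strictly on one side of `1`
(`eq_inv_trace_of_psdSpectralRadius_eq_one`). So the critical `α` is unique, which also identifies
any two definite solutions. -/

namespace PosRiccati

/-! ### The Loewner order, trace and Frobenius norm -/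

section PsdOrder

open Matrix
open scoped MatrixOrder

variable {n : ℕ}

theorem le_iff_dotProduct {X Y : Matrix (Fin n) (Fin n) ℝ} (hX : X.IsHermitian)
    (hY : Y.IsHermitian) : X ≤ Y ↔ ∀ v, v ⬝ᵥ X *ᵥ v ≤ v ⬝ᵥ Y *ᵥ v := by
  rw [Matrix.le_iff]
  constructor
  · intro h v
    have := h.dotProduct_mulVec_nonneg v
    simpa [sub_mulVec, dotProduct_sub] using this
  · intro h
    refine .of_dotProduct_mulVec_nonneg (hY.sub hX) fun v => ?_
    simpa [sub_mulVec, dotProduct_sub] using h v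

theorem dotProduct_le_of_le {X Y : Matrix (Fin n) (Fin n) ℝ} (h : X ≤ Y) (v : Fin n → ℝ) :
    v ⬝ᵥ X *ᵥ v ≤ v ⬝ᵥ Y *ᵥ v := by
  have := (Matrix.le_iff.1 h).dotProduct_mulVec_nonneg v
  simpa [sub_mulVec, dotProduct_sub] using this

theorem dotProduct_nonneg {X : Matrix (Fin n) (Fin n) ℝ} (h : 0 ≤ X) (v : Fin n → ℝ) :
    0 ≤ v ⬝ᵥ X *ᵥ v := by
  simpa using dotProduct_le_of_le h v

theorem isHermitian_of_nonneg {X : Matrix (Fin n) (Fin n) ℝ} (h : 0 ≤ X) : X.IsHermitian :=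
  (nonneg_iff_posSemidef.1 h).1

theorem trace_mono {X Y : Matrix (Fin n) (Fin n) ℝ} (h : X ≤ Y) : X.trace ≤ Y.trace := by
  have := (Matrix.le_iff.1 h).trace_nonneg
  rw [trace_sub] at this
  linarith

theorem trace_pos_of_ne_zero {X : Matrix (Fin n) (Fin n) ℝ} (h : 0 ≤ X) (h0 : X ≠ 0) :
    0 < X.trace := by
  have h' := nonneg_iff_posSemidef.1 h
  exact lt_of_le_of_ne h'.trace_nonneg fun e => h0 (h'.trace_eq_zero_iff.1 e.symm)

/-- A positive definite matrix is an order unit. -/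
theorem exists_le_smul {W : Matrix (Fin n) (Fin n) ℝ} (hW : W.PosDef)
    {X : Matrix (Fin n) (Fin n) ℝ} (hX : X.IsHermitian) : ∃ c : ℝ, 0 < c ∧ X ≤ c • W := by
  cases subsingleton_or_nontrivial (Matrix (Fin n) (Fin n) ℝ) with
  | inl h => exact ⟨1, one_pos, (Subsingleton.elim _ _).le⟩
  | inr h =>
    obtain ⟨r, hr, hrW⟩ := (CFC.exists_pos_algebraMap_le_iff (A := Matrix (Fin n) (Fin n) ℝ)
      (a := W) hW.isStrictlyPositive.isSelfAdjoint).2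
      fun x hx => hW.isStrictlyPositive.spectrum_pos hx
    obtain ⟨s, hs⟩ := (finite_real_spectrum (A := X)).bddAbove
    have h1 : X ≤ algebraMap ℝ (Matrix (Fin n) (Fin n) ℝ) (|s| + 1) :=
      le_algebraMap_of_spectrum_le (fun x hx => by
        have := hs hx
        have := le_abs_self s
        linarith) hX
    have hs0 : 0 < |s| + 1 := by positivity
    refine ⟨(|s| + 1) / r, by positivity, h1.trans ?_⟩
    have := smul_le_smul_of_nonneg_left hrW (div_pos hs0 hr).le
    rwa [Algebra.algebraMap_eq_smul_one, smul_smul, div_mul_cancel₀ _ hr.ne',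
      ← Algebra.algebraMap_eq_smul_one] at this

theorem exists_smul_le {W : Matrix (Fin n) (Fin n) ℝ} (hW : W.PosDef)
    {X : Matrix (Fin n) (Fin n) ℝ} (hX : X.IsHermitian) : ∃ c : ℝ, 0 < c ∧ c • X ≤ W := by
  obtain ⟨c, hc, h⟩ := exists_le_smul hW hX
  refine ⟨c⁻¹, inv_pos.2 hc, ?_⟩
  have := smul_le_smul_of_nonneg_left h (inv_pos.2 hc).le
  rwa [smul_smul, inv_mul_cancel₀ hc.ne', one_smul] at this

theorem eq_of_forall_dotProduct {X Y : Matrix (Fin n) (Fin n) ℝ} (hX : X.IsHermitian)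
    (hY : Y.IsHermitian) (h : ∀ v, v ⬝ᵥ X *ᵥ v = v ⬝ᵥ Y *ᵥ v) : X = Y :=
  le_antisymm ((le_iff_dotProduct hX hY).2 fun v => (h v).le)
    ((le_iff_dotProduct hY hX).2 fun v => (h v).ge)

/-- Testing on `e_i ± e_j` gives `2 |X i j| ≤ X i i + X j j`. -/
theorem abs_apply_le_trace {X : Matrix (Fin n) (Fin n) ℝ} (h : 0 ≤ X) (i j : Fin n) :
    |X i j| ≤ X.trace := by
  have hp := nonneg_iff_posSemidef.1 h
  have hd : ∀ i, X i i ≤ X.trace := fun i =>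
    Finset.single_le_sum (f := fun i => X i i) (fun i _ => hp.diag_nonneg) (Finset.mem_univ i)
  have hs : X j i = X i j := by simpa using hp.1.apply i j
  have h1 := dotProduct_nonneg h (Pi.single i 1 + Pi.single j 1)
  have h2 := dotProduct_nonneg h (Pi.single i 1 - Pi.single j 1)
  simp [mulVec_add, mulVec_sub, add_dotProduct, sub_dotProduct] at h1 h2
  have := hd i
  have := hd j
  rw [abs_le]
  constructor <;> linarith

open scoped Matrix.Norms.Frobenius in
theorem exists_norm_le_trace (n : ℕ) : ∃ K : ℝ, 0 < K ∧
    ∀ X : Matrix (Fin n) (Fin n) ℝ, 0 ≤ X → ‖X‖ ≤ K * X.trace := by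
  let K : ℝ := ∑ i : Fin n, ∑ j : Fin n, ‖Matrix.single i j (1 : ℝ)‖
  -- The added `1` keeps the constant positive when `n = 0`.
  refine ⟨K + 1, by positivity, fun X hX => ?_⟩
  have h0 : 0 ≤ X.trace := (nonneg_iff_posSemidef.1 hX).trace_nonneg
  calc ‖X‖ = ‖∑ i, ∑ j, X i j • Matrix.single i j (1 : ℝ)‖ := by
        congr 1
        conv_lhs => rw [matrix_eq_sum_single X]
        simp
    _ ≤ ∑ i, ∑ j, ‖X i j • Matrix.single i j (1 : ℝ)‖ :=
        (norm_sum_le _ _).trans (Finset.sum_le_sum fun i _ => norm_sum_le _ _)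
    _ ≤ ∑ i : Fin n, ∑ j : Fin n, X.trace * ‖Matrix.single i j (1 : ℝ)‖ := by
        gcongr with i _ j _
        rw [norm_smul]
        gcongr
        exact abs_apply_le_trace hX i j
    _ = K * X.trace := by simp_rw [← Finset.mul_sum]; exact mul_comm _ _
    _ ≤ (K + 1) * X.trace := by gcongr; linarith

open scoped Matrix.Norms.Frobenius in
theorem exists_trace_le_norm (n : ℕ) : ∃ K : ℝ, 0 < K ∧
    ∀ X : Matrix (Fin n) (Fin n) ℝ, X.trace ≤ K * ‖X‖ := by
  refine ⟨n + 1, by positivity, fun X => ?_⟩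
  have h (i : Fin n) : X i i ≤ ‖X‖ := by
    let Y : PiLp 2 fun _ : Fin n => PiLp 2 fun _ : Fin n => ℝ :=
      WithLp.toLp 2 fun i => WithLp.toLp 2 (X i)
    calc X i i ≤ ‖X i i‖ := Real.le_norm_self _
      _ ≤ ‖WithLp.toLp 2 (X i)‖ := PiLp.norm_apply_le (WithLp.toLp 2 (X i)) i
      _ ≤ ‖Y‖ := PiLp.norm_apply_le Y i
  calc X.trace ≤ ∑ _i : Fin n, ‖X‖ := Finset.sum_le_sum fun i _ => h i
    _ = n * ‖X‖ := by simp
    _ ≤ (n + 1) * ‖X‖ := by gcongr; linarith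

end PsdOrder

end PosRiccati

namespace PosRiccati

/-! ### Superlinear maps: contraction towards a fixed ray -/

section Superlinear

open Matrix
open scoped MatrixOrder

variable {n : ℕ}

/-- Positively homogeneous, superadditive self-maps of the positive semidefinite cone. -/
structure IsPsdSuperlinear (F : Matrix (Fin n) (Fin n) ℝ → Matrix (Fin n) (Fin n) ℝ) : Prop where
  nonneg : ∀ {X}, 0 ≤ X → 0 ≤ F X
  add_le : ∀ {X Y}, 0 ≤ X → 0 ≤ Y → F X + F Y ≤ F (X + Y)
  map_smul : ∀ {c : ℝ} {X}, 0 ≤ c → 0 ≤ X → F (c • X) = c • F X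

namespace IsPsdSuperlinear

variable {F G : Matrix (Fin n) (Fin n) ℝ → Matrix (Fin n) (Fin n) ℝ}
  {P X Y : Matrix (Fin n) (Fin n) ℝ}

/-- Split `Y = X + (Y - X)`; superadditivity leaves the nonnegative term `F (Y - X)` to spare. -/
theorem mono (hF : IsPsdSuperlinear F) (hX : 0 ≤ X) (h : X ≤ Y) : F X ≤ F Y := by
  have h1 := hF.add_le hX (sub_nonneg.2 h)
  rw [add_sub_cancel] at h1
  exact (le_add_of_nonneg_right (hF.nonneg (sub_nonneg.2 h))).trans h1

theorem comp (hF : IsPsdSuperlinear F) (hG : IsPsdSuperlinear G) : IsPsdSuperlinear (F ∘ G) where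
  nonneg hX := hF.nonneg (hG.nonneg hX)
  add_le hX hY := (hF.add_le (hG.nonneg hX) (hG.nonneg hY)).trans
    (hF.mono (add_nonneg (hG.nonneg hX) (hG.nonneg hY)) (hG.add_le hX hY))
  map_smul hc hX := by
    simp only [Function.comp_apply]
    rw [hG.map_smul hc hX, hF.map_smul hc (hG.nonneg hX)]

theorem iterate (hF : IsPsdSuperlinear F) (k : ℕ) : IsPsdSuperlinear F^[k] := by
  induction k with
  | zero => exact ⟨fun h => h, fun _ _ => le_rfl, fun _ _ => rfl⟩
  | succ k ih => exact ih.comp hF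

theorem iterate_smul_le (hF : IsPsdSuperlinear F) (hP : 0 ≤ P) (hFP : F P = P) {a : ℝ}
    (ha : 0 ≤ a) (h : a • P ≤ X) (k : ℕ) : a • P ≤ F^[k] X := by
  have := (hF.iterate k).mono (smul_nonneg ha hP) h
  rwa [(hF.iterate k).map_smul ha hP, Function.iterate_fixed hFP] at this

theorem iterate_le_smul (hF : IsPsdSuperlinear F) (hP : 0 ≤ P) (hFP : F P = P) (hX : 0 ≤ X) {b : ℝ}
    (hb : 0 ≤ b) (h : X ≤ b • P) (k : ℕ) : F^[k] X ≤ b • P := by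
  have := (hF.iterate k).mono hX h
  rwa [(hF.iterate k).map_smul hb hP, Function.iterate_fixed hFP] at this

/-- Convergence of the iterates to a ray, by a Birkhoff-type contraction of order intervals. -/
theorem exists_eventually_le (hF : IsPsdSuperlinear F) (hP : P.PosDef) (hFP : F P = P)
    {N : ℕ} {δ : ℝ} (hδ : 0 < δ) (h : ∀ Z, 0 ≤ Z → (δ * Z.trace) • P ≤ F^[N] Z)
    (hX : 0 ≤ X) (hX0 : X ≠ 0) :
    ∃ c : ℝ, 0 < c ∧ ∀ ε > 0, ∀ᶠ k in atTop, (c - ε) • P ≤ F^[k] X ∧ F^[k] X ≤ (c + ε) • P := by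
  have hP' : 0 ≤ P := nonneg_iff_posSemidef.2 hP.posSemidef
  obtain ⟨b₀, hb₀, hXb⟩ := exists_le_smul hP (isHermitian_of_nonneg hX)
  have hP0 : P ≠ 0 := by
    rintro rfl
    exact hX0 (le_antisymm (by simpa using hXb) hX)
  have hτ : 0 < P.trace := trace_pos_of_ne_zero hP' hP0
  have hle : ∀ {a b : ℝ}, a • P ≤ b • P → a ≤ b := fun {a b} hab => by
    have := trace_mono hab
    simp only [trace_smul, smul_eq_mul] at this
    exact le_of_mul_le_mul_right this hτ
  -- Superadditivity carries each of the gaps `Y - a P` and `b P - Y` through `F^[N]` separately,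
  -- and `h` turns its image into a multiple of `P`.
  have hstep : ∀ {a b : ℝ} {Y}, 0 ≤ a → 0 ≤ b → 0 ≤ Y → a • P ≤ Y → Y ≤ b • P →
      (a + δ * (Y - a • P).trace) • P ≤ F^[N] Y ∧ F^[N] Y ≤ (b - δ * (b • P - Y).trace) • P := by
    intro a b Y ha hb hY h1 h2
    constructor
    · have h3 := (hF.iterate N).add_le (smul_nonneg ha hP') (sub_nonneg.2 h1)
      rw [add_sub_cancel, (hF.iterate N).map_smul ha hP', Function.iterate_fixed hFP] at h3
      rw [add_smul]
      exact (add_le_add_right (h _ (sub_nonneg.2 h1)) _).trans h3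
    · have h3 := (hF.iterate N).add_le hY (sub_nonneg.2 h2)
      rw [add_sub_cancel, (hF.iterate N).map_smul hb hP', Function.iterate_fixed hFP] at h3
      rw [sub_smul]
      exact le_sub_iff_add_le.2 ((add_le_add_right (h _ (sub_nonneg.2 h2)) _).trans h3)
  let Y : ℕ → Matrix (Fin n) (Fin n) ℝ := fun j => F^[N * j] X
  have hYs : ∀ j, Y (j + 1) = F^[N] (Y j) := fun j => by
    simp only [Y]
    rw [← Function.iterate_add_apply, Nat.mul_succ, add_comm]
  have hY : ∀ j, 0 ≤ Y j := fun j => (hF.iterate _).nonneg hX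
  let a : ℕ → ℝ := fun j => Nat.rec 0 (fun i a => a + δ * (Y i - a • P).trace) j
  let b : ℕ → ℝ := fun j => Nat.rec b₀ (fun i b => b - δ * (b • P - Y i).trace) j
  have has : ∀ j, a (j + 1) = a j + δ * (Y j - a j • P).trace := fun j => rfl
  have hbs : ∀ j, b (j + 1) = b j - δ * (b j • P - Y j).trace := fun j => rfl
  have key : ∀ j, 0 ≤ a j ∧ a j • P ≤ Y j ∧ Y j ≤ b j • P ∧ a j ≤ b j := by
    intro j
    induction j with
    | zero => exact ⟨le_rfl, by simpa [a, Y] using hX, hXb, hb₀.le⟩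
    | succ j ih =>
      obtain ⟨h0, h1, h2, h3⟩ := ih
      obtain ⟨h4, h5⟩ := hstep h0 (h0.trans h3) (hY j) h1 h2
      rw [← has, ← hYs] at h4
      rw [← hbs, ← hYs] at h5
      have ht : 0 ≤ (Y j - a j • P).trace :=
        (nonneg_iff_posSemidef.1 (sub_nonneg.2 h1)).trace_nonneg
      exact ⟨by rw [has]; positivity, h4, h5, hle (h4.trans h5)⟩
  have hmono : Monotone a := monotone_nat_of_le_succ fun j => by
    rw [has]
    have := (nonneg_iff_posSemidef.1 (sub_nonneg.2 (key j).2.1)).trace_nonneg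
    exact le_add_of_nonneg_right (mul_nonneg hδ.le this)
  have hanti : Antitone b := antitone_nat_of_succ_le fun j => by
    rw [hbs]
    have := (nonneg_iff_posSemidef.1 (sub_nonneg.2 (key j).2.2.1)).trace_nonneg
    exact sub_le_self _ (mul_nonneg hδ.le this)
  -- The traces of the two gaps add up to `(b - a) tr P`, so the recursion contracts by exactly `1 -
  -- δ tr P`.
  have hgap : ∀ j, b j - a j = (1 - δ * P.trace) ^ j * b₀ := by
    intro j
    induction j with
    | zero => simp [a, b]
    | succ j ih =>
      rw [hbs, has, pow_succ, mul_assoc, mul_comm (1 - _), ← mul_assoc, ← ih]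
      simp only [trace_sub, trace_smul, smul_eq_mul]
      ring
  have hδτ : δ * P.trace ≤ 1 := by
    have := h P hP'
    rw [Function.iterate_fixed hFP, ← one_smul ℝ P, smul_smul, mul_one] at this
    simpa using hle this
  have hgap0 : Tendsto (fun j => b j - a j) atTop (𝓝 0) := by
    simp_rw [hgap]
    have := (tendsto_pow_atTop_nhds_zero_of_lt_one (sub_nonneg.2 hδτ)
      (sub_lt_self 1 (mul_pos hδ hτ))).mul_const b₀
    rwa [zero_mul] at this
  have hbdd : ∀ i j, a i ≤ b j := fun i j =>
    (hmono (le_max_left i j)).trans ((key _).2.2.2.trans (hanti (le_max_right i j)))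
  have hBdd : BddAbove (Set.range a) := ⟨b 0, by rintro _ ⟨i, rfl⟩; exact hbdd i 0⟩
  -- The lower bounds start at `a 0 = 0`; positivity of their supremum `c` comes from the first
  -- step.
  have h1 : 0 < a 1 := by
    have : a 1 = δ * X.trace := by simp [a, Y]
    rw [this]
    exact mul_pos hδ (trace_pos_of_ne_zero hX hX0)
  refine ⟨⨆ j, a j, h1.trans_le (le_ciSup hBdd 1), fun ε hε => ?_⟩
  obtain ⟨j, hj⟩ := (hgap0.eventually (gt_mem_nhds hε)).exists
  have hac : a j ≤ ⨆ j, a j := le_ciSup hBdd j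
  have hcb : ⨆ j, a j ≤ b j := ciSup_le fun i => hbdd i j
  -- The order interval `[a P, b P]` is invariant under `F`, so the bounds found at time `N * j`
  -- persist at all later times, not only at multiples of `N`.
  filter_upwards [eventually_ge_atTop (N * j)] with k hk
  obtain ⟨i, rfl⟩ := Nat.exists_eq_add_of_le hk
  have e : F^[N * j + i] X = F^[i] (Y j) := by
    rw [add_comm, Function.iterate_add_apply]
  rw [e]
  obtain ⟨k0, k1, k2, k3⟩ := key j
  exact ⟨(smul_le_smul_of_nonneg_right (by linarith) hP').trans
      (hF.iterate_smul_le hP' hFP k0 k1 i),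
    (hF.iterate_le_smul hP' hFP (hY j) (k0.trans k3) k2 i).trans
      (smul_le_smul_of_nonneg_right (by linarith) hP')⟩

end IsPsdSuperlinear

theorem eq_smul_of_forall_le {P Y : Matrix (Fin n) (Fin n) ℝ} (hP : P.IsHermitian)
    (hY : Y.IsHermitian) {c : ℝ} (h : ∀ ε > 0, (c - ε) • P ≤ Y ∧ Y ≤ (c + ε) • P) :
    Y = c • P := by
  have ht {d : ℝ} (v : Fin n → ℝ) : v ⬝ᵥ (d • P) *ᵥ v = d * (v ⬝ᵥ P *ᵥ v) := by
    rw [smul_mulVec, dotProduct_smul, smul_eq_mul]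
  refine eq_of_forall_dotProduct hY (hP.smul (IsSelfAdjoint.all c)) fun v => ?_
  have l1 : Tendsto (fun ε : ℝ => (c + ε) * (v ⬝ᵥ P *ᵥ v)) (𝓝[>] 0)
      (𝓝 ((c + 0) * (v ⬝ᵥ P *ᵥ v))) :=
    ((by fun_prop : Continuous fun ε : ℝ => (c + ε) * (v ⬝ᵥ P *ᵥ v)).tendsto 0).mono_left
      nhdsWithin_le_nhds
  have l2 : Tendsto (fun ε : ℝ => (c - ε) * (v ⬝ᵥ P *ᵥ v)) (𝓝[>] 0)
      (𝓝 ((c - 0) * (v ⬝ᵥ P *ᵥ v))) :=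
    ((by fun_prop : Continuous fun ε : ℝ => (c - ε) * (v ⬝ᵥ P *ᵥ v)).tendsto 0).mono_left
      nhdsWithin_le_nhds
  rw [ht]
  apply le_antisymm
  · rw [add_zero] at l1
    refine ge_of_tendsto l1 ?_
    filter_upwards [self_mem_nhdsWithin] with ε hε
    rw [← ht]
    exact dotProduct_le_of_le (h ε hε).2 v
  · rw [sub_zero] at l2
    refine le_of_tendsto l2 ?_
    filter_upwards [self_mem_nhdsWithin] with ε hε
    rw [← ht]
    exact dotProduct_le_of_le (h ε hε).1 v

/-! ### From order bounds to the Hilbert metric -/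

theorem coneLE_psdCone {X Y : Matrix (Fin n) (Fin n) ℝ} : ConeLE (psdCone n) X Y ↔ X ≤ Y :=
  Matrix.le_iff.symm

theorem hilbertInf_le_hilbertSup {X P : Matrix (Fin n) (Fin n) ℝ} (hP : 0 ≤ P) (hP0 : P ≠ 0) :
    hilbertInf (psdCone n) X P ≤ hilbertSup (psdCone n) X P := by
  refine iSup₂_le fun l hl => le_iInf₂ fun m hm => ?_
  rw [coneLE_psdCone] at hl hm
  have := trace_mono (hl.trans hm)
  simp only [trace_smul, smul_eq_mul] at this
  exact_mod_cast le_of_mul_le_mul_right this (trace_pos_of_ne_zero hP hP0)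

/-- Eventually `c - ε ≤ m ≤ M ≤ c + ε`, so `M / m` tends to `c / c = 1`, where the logarithm is
continuous. -/
theorem tendsto_hilbertMetric {P : Matrix (Fin n) (Fin n) ℝ} (hP : 0 ≤ P) (hP0 : P ≠ 0)
    {X : ℕ → Matrix (Fin n) (Fin n) ℝ} {c : ℝ} (hc : 0 < c)
    (h : ∀ ε > 0, ∀ᶠ k in atTop, (c - ε) • P ≤ X k ∧ X k ≤ (c + ε) • P) :
    Tendsto (fun k => hilbertMetric (psdCone n) (X k) P) atTop (𝓝 0) := by
  have hsup : ∀ {d : ℝ} {k}, 0 ≤ d → X k ≤ d • P →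
      hilbertSup (psdCone n) (X k) P ≤ ENNReal.ofReal d := fun {d k} hd hk =>
    iInf₂_le (⟨d, hd⟩ : ℝ≥0) (coneLE_psdCone.2 hk) |>.trans_eq
      (ENNReal.ofReal_eq_coe_nnreal hd).symm
  have hinf : ∀ {d : ℝ} {k}, 0 ≤ d → d • P ≤ X k →
      ENNReal.ofReal d ≤ hilbertInf (psdCone n) (X k) P := fun {d k} hd hk =>
    (ENNReal.ofReal_eq_coe_nnreal hd).trans_le
      (le_iSup₂_of_le (⟨d, hd⟩ : ℝ≥0) (coneLE_psdCone.2 hk) le_rfl)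
  have hq : Tendsto (fun k => hilbertSup (psdCone n) (X k) P / hilbertInf (psdCone n) (X k) P)
      atTop (𝓝 1) := by
    have hs : Tendsto (fun k => hilbertSup (psdCone n) (X k) P) atTop (𝓝 (ENNReal.ofReal c)) ∧
        Tendsto (fun k => hilbertInf (psdCone n) (X k) P) atTop (𝓝 (ENNReal.ofReal c)) := by
      have hb : ∀ ε > 0, ε < c → ∀ᶠ k in atTop,
          ENNReal.ofReal (c - ε) ≤ hilbertInf (psdCone n) (X k) P ∧
          hilbertSup (psdCone n) (X k) P ≤ ENNReal.ofReal (c + ε) := by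
        intro ε hε hεc
        filter_upwards [h ε hε] with k hk
        exact ⟨hinf (by linarith) hk.1, hsup (by linarith) hk.2⟩
      have hl : ∀ x < ENNReal.ofReal c, ∀ᶠ k in atTop, x < hilbertInf (psdCone n) (X k) P := by
        intro x hx
        have hxc : x.toReal < c := by
          rwa [← ENNReal.lt_ofReal_iff_toReal_lt (hx.trans ENNReal.ofReal_lt_top).ne]
        have hx0 : 0 ≤ x.toReal := ENNReal.toReal_nonneg
        filter_upwards [hb ((c - x.toReal) / 2) (by linarith) (by linarith)] with k hk
        refine lt_of_lt_of_le ?_ hk.1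
        rw [ENNReal.lt_ofReal_iff_toReal_lt (hx.trans ENNReal.ofReal_lt_top).ne]
        linarith
      have hu : ∀ x > ENNReal.ofReal c, ∀ᶠ k in atTop, hilbertSup (psdCone n) (X k) P < x := by
        intro x hx
        obtain ⟨d, hcd, hdx⟩ := ENNReal.lt_iff_exists_nnreal_btwn.1 hx
        have hcd' : c < d := by
          have := (ENNReal.ofReal_lt_iff_lt_toReal hc.le ENNReal.coe_ne_top).1 hcd
          simpa using this
        -- `hb` requires `ε < c`, hence the cap at `c / 2`.
        filter_upwards [hb (min ((d : ℝ) - c) (c / 2)) (lt_min (by linarith) (by linarith))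
          ((min_le_right _ _).trans_lt (by linarith))] with k hk
        refine (hk.2.trans ?_).trans_lt hdx
        rw [ENNReal.ofReal_le_iff_le_toReal ENNReal.coe_ne_top, ENNReal.coe_toReal]
        have := min_le_left ((d : ℝ) - c) (c / 2)
        linarith
      refine ⟨tendsto_order.2 ⟨fun x hx => ?_, hu⟩, tendsto_order.2 ⟨hl, fun x hx => ?_⟩⟩
      · filter_upwards [hl x hx] with k hk
        exact hk.trans_le (hilbertInf_le_hilbertSup hP hP0)
      · filter_upwards [hu x hx] with k hk
        exact (hilbertInf_le_hilbertSup hP hP0).trans_lt hk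
    have hc0 : ENNReal.ofReal c ≠ 0 := by simpa using hc
    have := ENNReal.Tendsto.div hs.1 (.inl hc0) hs.2 (.inl ENNReal.ofReal_ne_top)
    rwa [ENNReal.div_self hc0 ENNReal.ofReal_ne_top] at this
  have := (ENNReal.continuous_log.tendsto 1).comp hq
  rwa [ENNReal.log_one] at this

end Superlinear

end PosRiccati

namespace PosRiccati

/-! ### Bounds on the cone spectral radius -/

section SpectralRadius

open Matrix
open scoped MatrixOrder

variable {n : ℕ}

theorem tendsto_ofReal_mul_pow_rpow {C s : ℝ} (hC : 0 < C) (hs : 0 < s) :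
    Tendsto (fun k : ℕ => ENNReal.ofReal (C * s ^ k) ^ (1 / (k : ℝ))) atTop
      (𝓝 (ENNReal.ofReal s)) := by
  have h1 : Tendsto (fun k : ℕ => C ^ (1 / (k : ℝ)) * s) atTop (𝓝 s) := by
    have := ((Real.continuousAt_const_rpow hC.ne').tendsto.comp
      tendsto_one_div_atTop_nhds_zero_nat).mul_const s
    simpa using this
  refine (ENNReal.tendsto_ofReal h1).congr' ?_
  filter_upwards [eventually_gt_atTop 0] with k hk
  rw [ENNReal.ofReal_rpow_of_nonneg (by positivity) (by positivity),
    Real.mul_rpow hC.le (by positivity), one_div, Real.pow_rpow_inv_natCast hs.le hk.ne']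

namespace IsPsdSuperlinear

variable {F : Matrix (Fin n) (Fin n) ℝ → Matrix (Fin n) (Fin n) ℝ} {P : Matrix (Fin n) (Fin n) ℝ}

-- A definite `P` dominates a multiple of every `X`, so by monotonicity its growth rate bounds all
-- others; constants vanish under the `k`-th root.
open scoped Matrix.Norms.Frobenius in
theorem psdSpectralRadius_le (hF : IsPsdSuperlinear F) (hP : P.PosDef) {C s : ℝ} (hC : 0 < C)
    (hs : 0 < s) (h : ∀ k, F^[k] P ≤ (C * s ^ k) • P) :
    psdSpectralRadius F ≤ ENNReal.ofReal s := by
  have hP' : 0 ≤ P := nonneg_iff_posSemidef.2 hP.posSemidef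
  obtain ⟨K, hK, hKX⟩ := exists_norm_le_trace n
  refine iSup₂_le fun X hX => ?_
  have hX' : 0 ≤ X := nonneg_iff_posSemidef.2 hX
  obtain ⟨d, hd, hXd⟩ := exists_le_smul hP hX.1
  have hτ : 0 ≤ P.trace := hP.posSemidef.trace_nonneg
  have hb : ∀ k, ‖F^[k] X‖ ≤ (K * d * C * (P.trace + 1)) * s ^ k := by
    intro k
    have h1 := (hF.iterate k).mono hX' hXd
    rw [(hF.iterate k).map_smul hd.le hP'] at h1
    have h2 := trace_mono (h1.trans (smul_le_smul_of_nonneg_left (h k) hd.le))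
    simp only [trace_smul, smul_eq_mul] at h2
    calc ‖F^[k] X‖ ≤ K * (F^[k] X).trace := hKX _ ((hF.iterate k).nonneg hX')
      _ ≤ K * (d * (C * s ^ k * P.trace)) := by gcongr
      _ ≤ K * (d * (C * s ^ k * (P.trace + 1))) := by gcongr; linarith
      _ = _ := by ring
  rw [← (tendsto_ofReal_mul_pow_rpow (C := K * d * C * (P.trace + 1)) (by positivity) hs).limsup_eq]
  refine limsup_le_limsup (.of_forall fun k => ?_)
  refine ENNReal.rpow_le_rpow ?_ (by positivity)
  rw [← ofReal_norm]
  exact ENNReal.ofReal_le_ofReal (hb k)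

open scoped Matrix.Norms.Frobenius in
theorem le_psdSpectralRadius (hP : 0 ≤ P) (hP0 : P ≠ 0)
    {C s : ℝ} (hC : 0 < C) (hs : 0 < s) (h : ∀ k, (C * s ^ k) • P ≤ F^[k] P) :
    ENNReal.ofReal s ≤ psdSpectralRadius F := by
  obtain ⟨K, hK, hKX⟩ := exists_trace_le_norm n
  have hτ : 0 < P.trace := trace_pos_of_ne_zero hP hP0
  refine le_trans ?_ (le_iSup₂_of_le P (nonneg_iff_posSemidef.1 hP) le_rfl)
  have hb : ∀ k, (C * P.trace / K) * s ^ k ≤ ‖F^[k] P‖ := by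
    intro k
    have h1 := (trace_mono (h k)).trans (hKX _)
    simp only [trace_smul, smul_eq_mul] at h1
    rw [div_mul_eq_mul_div, div_le_iff₀ hK]
    linarith
  rw [← (tendsto_ofReal_mul_pow_rpow (C := C * P.trace / K) (by positivity) hs).limsup_eq]
  refine limsup_le_limsup (.of_forall fun k => ?_)
  refine ENNReal.rpow_le_rpow ?_ (by positivity)
  rw [← ofReal_norm]
  exact ENNReal.ofReal_le_ofReal (hb k)

theorem psdSpectralRadius_eq_one (hF : IsPsdSuperlinear F) (hP : P.PosDef) (hP0 : P ≠ 0)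
    (hFP : F P = P) : psdSpectralRadius F = 1 := by
  rw [← ENNReal.ofReal_one]
  refine le_antisymm (hF.psdSpectralRadius_le hP one_pos one_pos fun k => ?_)
    (le_psdSpectralRadius (nonneg_iff_posSemidef.2 hP.posSemidef) hP0 one_pos one_pos fun k => ?_)
  all_goals simp [Function.iterate_fixed hFP]

/-- If `P` is a subfixed point which some iterate of `F` strictly decreases, then the spectral
radius is less than `1`. -/
theorem psdSpectralRadius_lt_one (hF : IsPsdSuperlinear F) (hP : P.PosDef) (hFP : F P ≤ P)
    {N : ℕ} (hN : N ≠ 0) {r : ℝ} (hr : 0 < r) (hr1 : r < 1) (h : F^[N] P ≤ r • P) :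
    psdSpectralRadius F < 1 := by
  have hP' : 0 ≤ P := nonneg_iff_posSemidef.2 hP.posSemidef
  set s : ℝ := r ^ ((N : ℝ)⁻¹)
  have hs : 0 < s := by positivity
  have hsN : s ^ N = r := Real.rpow_inv_natCast_pow hr.le hN
  have hs1 : s < 1 := Real.rpow_lt_one hr.le hr1 (by positivity)
  have hk1 : ∀ k, F^[k] P ≤ P := by
    intro k
    induction k with
    | zero => exact le_rfl
    | succ k ih =>
      rw [Function.iterate_succ_apply']
      exact (hF.mono ((hF.iterate k).nonneg hP') ih).trans hFP
  -- The rate per step is `s = r ^ (1 / N)`; the factor `r⁻¹` pays for the initial `k < N`, where `s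
  -- ^ k ≥ r`, and the induction then advances by `N`.
  refine (hF.psdSpectralRadius_le hP (C := r⁻¹) (by positivity) hs fun k => ?_).trans_lt ?_
  · induction k using Nat.strong_induction_on with
    | _ k ih =>
      rcases lt_or_ge k N with hk | hk
      · have : 1 ≤ r⁻¹ * s ^ k := by
          rw [← hsN, ← div_eq_inv_mul, one_le_div (by positivity)]
          exact pow_le_pow_of_le_one hs.le hs1.le hk.le
        have h2 := smul_le_smul_of_nonneg_right this hP'
        rw [one_smul] at h2
        exact (hk1 k).trans h2
      · obtain ⟨i, rfl⟩ := Nat.exists_eq_add_of_le' hk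
        rw [Function.iterate_add_apply]
        have h2 := (hF.iterate i).mono ((hF.iterate N).nonneg hP') h
        rw [(hF.iterate i).map_smul hr.le hP'] at h2
        refine h2.trans ((smul_le_smul_of_nonneg_left
          (ih i (Nat.lt_add_of_pos_right (Nat.pos_of_ne_zero hN))) hr.le).trans_eq ?_)
        rw [smul_smul, pow_add, hsN]
        congr 1
        ring
  · rw [← ENNReal.ofReal_one]
    exact (ENNReal.ofReal_lt_ofReal_iff one_pos).2 hs1

/-- If `P` is a superfixed point which some iterate of `F` strictly increases, then the spectral
radius is greater than `1`. -/
theorem one_lt_psdSpectralRadius (hF : IsPsdSuperlinear F) (hP : 0 ≤ P) (hP0 : P ≠ 0)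
    (hFP : P ≤ F P) {N : ℕ} (hN : N ≠ 0) {r : ℝ} (hr1 : 1 < r) (h : r • P ≤ F^[N] P) :
    1 < psdSpectralRadius F := by
  have hr : 0 < r := one_pos.trans hr1
  set s : ℝ := r ^ ((N : ℝ)⁻¹)
  have hs : 0 < s := by positivity
  have hsN : s ^ N = r := Real.rpow_inv_natCast_pow hr.le hN
  have hs1 : 1 < s := Real.one_lt_rpow hr1 (by positivity)
  have hk1 : ∀ k, P ≤ F^[k] P := by
    intro k
    induction k with
    | zero => exact le_rfl
    | succ k ih =>
      rw [Function.iterate_succ_apply']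
      exact hFP.trans (hF.mono hP ih)
  refine lt_of_lt_of_le ?_ (le_psdSpectralRadius hP hP0 (C := r⁻¹) (by positivity) hs fun k => ?_)
  · rw [← ENNReal.ofReal_one]
    exact (ENNReal.ofReal_lt_ofReal_iff hs).2 hs1
  · induction k using Nat.strong_induction_on with
    | _ k ih =>
      rcases lt_or_ge k N with hk | hk
      · have : r⁻¹ * s ^ k ≤ 1 := by
          rw [← hsN, ← div_eq_inv_mul, div_le_one (by positivity)]
          exact pow_le_pow_right₀ hs1.le hk.le
        have h2 := smul_le_smul_of_nonneg_right this hP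
        rw [one_smul] at h2
        exact h2.trans (hk1 k)
      · obtain ⟨i, rfl⟩ := Nat.exists_eq_add_of_le' hk
        rw [Function.iterate_add_apply]
        have h2 := (hF.iterate i).mono (smul_nonneg hr.le hP) h
        rw [(hF.iterate i).map_smul hr.le hP] at h2
        refine (Eq.trans_le ?_ (smul_le_smul_of_nonneg_left
          (ih i (Nat.lt_add_of_pos_right (Nat.pos_of_ne_zero hN))) hr.le)).trans h2
        rw [smul_smul, pow_add, hsN]
        congr 1
        ring

end IsPsdSuperlinear

end SpectralRadius

end PosRiccati

namespace PosRiccati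

noncomputable section

/-! The Riccati map as a value function -/

open Matrix
open scoped MatrixOrder

variable {n m p : ℕ} {A : Matrix (Fin n) (Fin n) ℝ} {B : Matrix (Fin n) (Fin p) ℝ}
  {C : Matrix (Fin m) (Fin n) ℝ} {R : Matrix (Fin p) (Fin p) ℝ}

/-- The Riccati map in which the weights `R` and `Cᵀ C` are scaled by `t`. -/
def riccatiMap (A : Matrix (Fin n) (Fin n) ℝ) (B : Matrix (Fin n) (Fin p) ℝ)
    (C : Matrix (Fin m) (Fin n) ℝ) (R : Matrix (Fin p) (Fin p) ℝ) (t : ℝ)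
    (X : Matrix (Fin n) (Fin n) ℝ) : Matrix (Fin n) (Fin n) ℝ :=
  Aᵀ * (X - X * B * (t • R + Bᵀ * X * B)⁻¹ * Bᵀ * X) * A + t • (Cᵀ * C)

/-- The one-step cost of the control `u` at the state `v`, with terminal cost `X`. -/
def stepCost (A : Matrix (Fin n) (Fin n) ℝ) (B : Matrix (Fin n) (Fin p) ℝ)
    (C : Matrix (Fin m) (Fin n) ℝ) (R : Matrix (Fin p) (Fin p) ℝ) (t : ℝ)
    (X : Matrix (Fin n) (Fin n) ℝ) (v : Fin n → ℝ) (u : Fin p → ℝ) : ℝ :=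
  (A *ᵥ v + B *ᵥ u) ⬝ᵥ X *ᵥ (A *ᵥ v + B *ᵥ u) + t * (u ⬝ᵥ R *ᵥ u) + t * (C *ᵥ v ⬝ᵥ C *ᵥ v)

theorem homF_eq (α : ℝ) (X : Matrix (Fin n) (Fin n) ℝ) :
    homF A B C R α X = riccatiMap A B C R (α * X.trace) X := rfl

theorem solvesDARE_iff {P : Matrix (Fin n) (Fin n) ℝ} :
    SolvesDARE A B C R P ↔ riccatiMap A B C R 1 P = P := by
  rw [SolvesDARE, riccatiMap, eq_comm, one_smul, one_smul]
  simp only [Matrix.mul_sub, Matrix.sub_mul, Matrix.mul_assoc]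

theorem dotProduct_transpose_mul_mul {k l : ℕ} (D : Matrix (Fin k) (Fin l) ℝ)
    (X : Matrix (Fin k) (Fin k) ℝ) (v : Fin l → ℝ) :
    v ⬝ᵥ (Dᵀ * X * D) *ᵥ v = D *ᵥ v ⬝ᵥ X *ᵥ (D *ᵥ v) := by
  rw [← mulVec_mulVec, ← mulVec_mulVec, dotProduct_mulVec, vecMul_transpose]

theorem dotProduct_transpose_mul_self {k l : ℕ} (D : Matrix (Fin k) (Fin l) ℝ)
    (v : Fin l → ℝ) : v ⬝ᵥ (Dᵀ * D) *ᵥ v = D *ᵥ v ⬝ᵥ D *ᵥ v := by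
  simpa using dotProduct_transpose_mul_mul D 1 v

theorem dotProduct_mulVec_comm {k : ℕ} {X : Matrix (Fin k) (Fin k) ℝ} (hX : X.IsHermitian)
    (v w : Fin k → ℝ) : v ⬝ᵥ X *ᵥ w = w ⬝ᵥ X *ᵥ v := by
  have : Xᵀ = X := hX
  rw [dotProduct_comm w, dotProduct_mulVec, ← mulVec_transpose, this]

theorem posDef_control {t : ℝ} (ht : 0 < t) (hR : R.PosDef) {X : Matrix (Fin n) (Fin n) ℝ}
    (hX : 0 ≤ X) : (t • R + Bᵀ * X * B).PosDef :=
  (hR.smul ht).add_posSemidef ((nonneg_iff_posSemidef.1 hX).conjTranspose_mul_mul_same B)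

theorem isHermitian_riccatiMap {t : ℝ} (hR : R.IsHermitian) {X : Matrix (Fin n) (Fin n) ℝ}
    (hX : X.IsHermitian) : (riccatiMap A B C R t X).IsHermitian := by
  have hX' : Xᵀ = X := hX
  have hR' : Rᵀ = R := hR
  change (riccatiMap A B C R t X)ᵀ = _
  simp [riccatiMap, transpose_nonsing_inv, hX', hR', Matrix.mul_assoc]

/-- Completion of the square. -/
theorem stepCost_eq {t : ℝ} {X : Matrix (Fin n) (Fin n) ℝ} (hX : X.IsHermitian)
    (hM : (t • R + Bᵀ * X * B).PosDef) (v : Fin n → ℝ) (u : Fin p → ℝ) :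
    stepCost A B C R t X v u = v ⬝ᵥ riccatiMap A B C R t X *ᵥ v +
      (u + (t • R + Bᵀ * X * B)⁻¹ *ᵥ (Bᵀ *ᵥ (X *ᵥ (A *ᵥ v)))) ⬝ᵥ (t • R + Bᵀ * X * B) *ᵥ
        (u + (t • R + Bᵀ * X * B)⁻¹ *ᵥ (Bᵀ *ᵥ (X *ᵥ (A *ᵥ v)))) := by
  have hXB : ∀ (x : Fin n → ℝ) (y : Fin p → ℝ), y ⬝ᵥ Bᵀ *ᵥ x = B *ᵥ y ⬝ᵥ x := fun x y => by
    rw [dotProduct_mulVec, vecMul_transpose]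
  have hu : t * (u ⬝ᵥ R *ᵥ u) + B *ᵥ u ⬝ᵥ X *ᵥ (B *ᵥ u) = u ⬝ᵥ (t • R + Bᵀ * X * B) *ᵥ u := by
    rw [add_mulVec, dotProduct_add, smul_mulVec, dotProduct_smul, dotProduct_transpose_mul_mul,
      smul_eq_mul]
  set M := t • R + Bᵀ * X * B with hMdef
  set x := A *ᵥ v with hx
  set g := Bᵀ *ᵥ (X *ᵥ x) with hg
  -- The minimising control is `-w`.
  set w := M⁻¹ *ᵥ g with hw
  have hMw : M *ᵥ w = g := by
    rw [hw, mulVec_mulVec, mul_nonsing_inv _ ((isUnit_iff_isUnit_det _).1 hM.isUnit), one_mulVec]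
  have hric : v ⬝ᵥ riccatiMap A B C R t X *ᵥ v =
      x ⬝ᵥ X *ᵥ x - w ⬝ᵥ g + t * (C *ᵥ v ⬝ᵥ C *ᵥ v) := by
    have h1 : x ⬝ᵥ (X * B * M⁻¹ * Bᵀ * X) *ᵥ x = w ⬝ᵥ g := by
      simp only [← mulVec_mulVec]
      rw [← hg, ← hw, dotProduct_mulVec_comm hX, ← hXB]
    rw [riccatiMap, ← hMdef, add_mulVec, dotProduct_add, dotProduct_transpose_mul_mul, ← hx,
      sub_mulVec, dotProduct_sub, smul_mulVec, dotProduct_smul, smul_eq_mul,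
      dotProduct_transpose_mul_self, h1]
  rw [hric, stepCost, ← hx]
  simp only [mulVec_add, dotProduct_add, add_dotProduct, hMw]
  have e1 : x ⬝ᵥ X *ᵥ (B *ᵥ u) = u ⬝ᵥ g := by
    rw [dotProduct_mulVec_comm hX, hg, hXB]
  have e2 : B *ᵥ u ⬝ᵥ X *ᵥ x = u ⬝ᵥ g := by rw [hg, hXB]
  have e3 : w ⬝ᵥ M *ᵥ u = u ⬝ᵥ g := by rw [dotProduct_mulVec_comm hM.1, hMw]
  rw [e1, e2, e3, ← hu]
  ring

theorem riccatiMap_zero_zero : riccatiMap A B C R 0 0 = 0 := by simp [riccatiMap]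

/-- The weight `t` is positive, or both the weight and the terminal cost vanish. -/
def Admissible (t : ℝ) (X : Matrix (Fin n) (Fin n) ℝ) : Prop :=
  0 ≤ X ∧ (0 < t ∨ t = 0 ∧ X = 0)

theorem dotProduct_riccatiMap_le (hR : R.PosDef) {t : ℝ} {X : Matrix (Fin n) (Fin n) ℝ}
    (h : Admissible t X) (v : Fin n → ℝ) (u : Fin p → ℝ) :
    v ⬝ᵥ riccatiMap A B C R t X *ᵥ v ≤ stepCost A B C R t X v u := by
  obtain ⟨hX, ht | ⟨rfl, rfl⟩⟩ := h
  · rw [stepCost_eq (isHermitian_of_nonneg hX) (posDef_control ht hR hX)]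
    have := (posDef_control (B := B) ht hR hX).posSemidef.dotProduct_mulVec_nonneg
    exact le_add_of_nonneg_right (this _)
  · simp [riccatiMap_zero_zero, stepCost]

/-- The completed square vanishes at this control, so with `dotProduct_riccatiMap_le` the Riccati
form is an attained minimum. -/
theorem exists_dotProduct_riccatiMap_eq (hR : R.PosDef) {t : ℝ} {X : Matrix (Fin n) (Fin n) ℝ}
    (h : Admissible t X) (v : Fin n → ℝ) :
    ∃ u, v ⬝ᵥ riccatiMap A B C R t X *ᵥ v = stepCost A B C R t X v u := by
  obtain ⟨hX, ht | ⟨rfl, rfl⟩⟩ := h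
  · refine ⟨-((t • R + Bᵀ * X * B)⁻¹ *ᵥ (Bᵀ *ᵥ (X *ᵥ (A *ᵥ v)))), ?_⟩
    rw [stepCost_eq (isHermitian_of_nonneg hX) (posDef_control ht hR hX)]
    simp
  · exact ⟨0, by simp [riccatiMap_zero_zero, stepCost]⟩

theorem Admissible.nonneg_left {t : ℝ} {X : Matrix (Fin n) (Fin n) ℝ} (h : Admissible t X) :
    0 ≤ t := by
  rcases h.2 with h | h
  exacts [h.le, h.1.ge]

theorem Admissible.add {s t : ℝ} {X Y : Matrix (Fin n) (Fin n) ℝ} (hX : Admissible s X)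
    (hY : Admissible t Y) : Admissible (s + t) (X + Y) := by
  refine ⟨add_nonneg hX.1 hY.1, ?_⟩
  have := hX.nonneg_left
  have := hY.nonneg_left
  rcases hX.2 with h | ⟨rfl, rfl⟩
  · exact .inl (by linarith)
  · simpa using hY.2

theorem real_dotProduct_self_nonneg (v : Fin n → ℝ) : 0 ≤ v ⬝ᵥ v := by
  simpa using dotProduct_star_self_nonneg v

theorem stepCost_nonneg (hR : R.PosDef) {t : ℝ} {X : Matrix (Fin n) (Fin n) ℝ} (ht : 0 ≤ t)
    (hX : 0 ≤ X) (v : Fin n → ℝ) (u : Fin p → ℝ) : 0 ≤ stepCost A B C R t X v u := by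
  have h1 := dotProduct_nonneg hX (A *ᵥ v + B *ᵥ u)
  have h2 := dotProduct_nonneg (nonneg_iff_posSemidef.2 hR.posSemidef) u
  have h3 := real_dotProduct_self_nonneg (C *ᵥ v)
  rw [stepCost]
  positivity

theorem riccatiMap_nonneg (hR : R.PosDef) {t : ℝ} {X : Matrix (Fin n) (Fin n) ℝ}
    (h : Admissible t X) : 0 ≤ riccatiMap A B C R t X := by
  refine (le_iff_dotProduct isHermitian_zero
    (isHermitian_riccatiMap hR.1 (isHermitian_of_nonneg h.1))).2 fun v => ?_
  obtain ⟨u, hu⟩ := exists_dotProduct_riccatiMap_eq (A := A) (B := B) (C := C) hR h v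
  rw [hu]
  simpa using stepCost_nonneg hR h.nonneg_left h.1 v u

theorem stepCost_add (s t : ℝ) (X Y : Matrix (Fin n) (Fin n) ℝ) (v : Fin n → ℝ) (u : Fin p → ℝ) :
    stepCost A B C R (s + t) (X + Y) v u =
      stepCost A B C R s X v u + stepCost A B C R t Y v u := by
  simp only [stepCost, add_mulVec, dotProduct_add]
  ring

/-- The control that is optimal for the sum is admissible in both problems: a minimum of a sum is at
least the sum of the minima. -/
theorem riccatiMap_add_le (hR : R.PosDef) {s t : ℝ} {X Y : Matrix (Fin n) (Fin n) ℝ}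
    (hX : Admissible s X) (hY : Admissible t Y) :
    riccatiMap A B C R s X + riccatiMap A B C R t Y ≤ riccatiMap A B C R (s + t) (X + Y) := by
  have h1 := riccatiMap_nonneg (A := A) (B := B) (C := C) hR hX
  have h2 := riccatiMap_nonneg (A := A) (B := B) (C := C) hR hY
  refine (le_iff_dotProduct (isHermitian_of_nonneg (add_nonneg h1 h2))
    (isHermitian_of_nonneg (riccatiMap_nonneg hR (hX.add hY)))).2 fun v => ?_
  obtain ⟨u, hu⟩ := exists_dotProduct_riccatiMap_eq (A := A) (B := B) (C := C) hR (hX.add hY) v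
  rw [hu, stepCost_add, add_mulVec, dotProduct_add]
  exact add_le_add (dotProduct_riccatiMap_le hR hX v u) (dotProduct_riccatiMap_le hR hY v u)

theorem riccatiMap_smul_smul {c : ℝ} (hc : c ≠ 0) (t : ℝ) (X : Matrix (Fin n) (Fin n) ℝ) :
    riccatiMap A B C R (c * t) (c • X) = c • riccatiMap A B C R t X := by
  have e : (c * t) • R + Bᵀ * (c • X) * B = c • (t • R + Bᵀ * X * B) := by
    simp [smul_smul]
  have e2 : (c • (t • R + Bᵀ * X * B))⁻¹ = c⁻¹ • (t • R + Bᵀ * X * B)⁻¹ := by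
    by_cases h : IsUnit (t • R + Bᵀ * X * B).det
    · have := inv_smul' (t • R + Bᵀ * X * B) (Units.mk0 c hc) h
      simpa [Units.smul_def] using this
    -- Both inverses are `0` by convention, so homogeneity survives the singular case.
    · have h' : ¬ IsUnit (c • (t • R + Bᵀ * X * B)).det := by
        rw [det_smul]
        simpa [hc] using h
      rw [nonsing_inv_apply_not_isUnit _ h, nonsing_inv_apply_not_isUnit _ h', smul_zero]
  rw [riccatiMap, riccatiMap, e, e2]
  simp only [Matrix.smul_mul, Matrix.mul_smul, smul_smul, smul_add, Matrix.mul_sub,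
    Matrix.sub_mul, smul_sub]
  rw [inv_mul_cancel₀ hc, mul_one]

theorem admissible_trace {α : ℝ} (hα : 0 < α) {X : Matrix (Fin n) (Fin n) ℝ} (hX : 0 ≤ X) :
    Admissible (α * X.trace) X := by
  refine ⟨hX, ?_⟩
  by_cases h : X = 0
  · exact .inr (by simp [h])
  · exact .inl (mul_pos hα (trace_pos_of_ne_zero hX h))

/-- The weight `α tr X` is linear in `X`, so the joint properties in `(t, X)` restrict to `X` alone.
-/
theorem isPsdSuperlinear_homF (hR : R.PosDef) {α : ℝ} (hα : 0 < α) :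
    IsPsdSuperlinear (homF A B C R α) where
  nonneg hX := riccatiMap_nonneg hR (admissible_trace hα hX)
  add_le {X Y} hX hY := by
    have := riccatiMap_add_le (A := A) (B := B) (C := C) hR (admissible_trace hα hX)
      (admissible_trace hα hY)
    rwa [← mul_add, ← trace_add] at this
  map_smul {c X} hc hX := by
    rw [homF_eq, homF_eq, trace_smul, smul_eq_mul]
    rcases hc.eq_or_lt with rfl | hc
    · simp [riccatiMap_zero_zero]
    · rw [mul_left_comm, riccatiMap_smul_smul hc.ne']

end

end PosRiccati

namespace PosRiccati

section Positivity

open Matrix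
open scoped MatrixOrder

variable {n m p : ℕ} {A : Matrix (Fin n) (Fin n) ℝ} {B : Matrix (Fin n) (Fin p) ℝ}
  {C : Matrix (Fin m) (Fin n) ℝ} {R : Matrix (Fin p) (Fin p) ℝ}

/-! Observability makes the iterates positive definite -/

theorem IsObservable.eq_zero (h : IsObservable A C) {v : Fin n → ℝ}
    (hv : ∀ k < n, C *ᵥ (A ^ k *ᵥ v) = 0) : v = 0 := by
  have h1 := (observabilityMatrix A C).mulVecLin.finrank_range_add_finrank_ker
  have h2 : Module.finrank ℝ (observabilityMatrix A C).mulVecLin.range = n := h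
  rw [h2, Module.finrank_fin_fun, Nat.add_eq_left, Submodule.finrank_eq_zero] at h1
  rw [← Submodule.mem_bot ℝ, ← h1, LinearMap.mem_ker, mulVecLin_apply]
  ext q
  have := congrFun (hv q.1 q.1.2) q.2
  rw [mulVec_mulVec] at this
  exact this

theorem IsObservable.transpose_mul_self_ne_zero (hn : 0 < n) (h : IsObservable A C) :
    Cᵀ * C ≠ 0 := by
  intro h0
  have hC : C = 0 := conjTranspose_mul_self_eq_zero.1 h0
  have := h.eq_zero (v := fun _ => 1) (by simp [hC])
  exact one_ne_zero (congrFun this ⟨0, hn⟩)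

theorem transpose_mul_self_nonneg (C : Matrix (Fin m) (Fin n) ℝ) : 0 ≤ Cᵀ * C :=
  nonneg_iff_posSemidef.2 (posSemidef_conjTranspose_mul_self C)

/-- The state cost is paid whatever the control, and the remaining costs are nonnegative. -/
theorem smul_le_riccatiMap (hR : R.PosDef) {t : ℝ} {X : Matrix (Fin n) (Fin n) ℝ}
    (h : Admissible t X) : t • (Cᵀ * C) ≤ riccatiMap A B C R t X := by
  have hC := smul_nonneg h.nonneg_left (transpose_mul_self_nonneg C)
  refine (le_iff_dotProduct (isHermitian_of_nonneg hC)
    (isHermitian_of_nonneg (riccatiMap_nonneg hR h))).2 fun v => ?_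
  obtain ⟨u, hu⟩ := exists_dotProduct_riccatiMap_eq (A := A) (B := B) (C := C) hR h v
  rw [hu, stepCost, smul_mulVec, dotProduct_smul, dotProduct_transpose_mul_self, smul_eq_mul]
  have h1 := dotProduct_nonneg h.1 (A *ᵥ v + B *ᵥ u)
  have h2 := mul_nonneg h.nonneg_left
    (dotProduct_nonneg (nonneg_iff_posSemidef.2 hR.posSemidef) u)
  linarith

/-- Zero optimal cost makes every summand vanish; definiteness of `R` then forces the optimal
control to be `0`, so the state moves freely to `A v`. -/
theorem of_dotProduct_riccatiMap_eq_zero (hR : R.PosDef) {t : ℝ} (ht : 0 < t)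
    {X : Matrix (Fin n) (Fin n) ℝ} (hX : 0 ≤ X) {v : Fin n → ℝ}
    (h : v ⬝ᵥ riccatiMap A B C R t X *ᵥ v = 0) :
    A *ᵥ v ⬝ᵥ X *ᵥ (A *ᵥ v) = 0 ∧ C *ᵥ v = 0 := by
  obtain ⟨u, hu⟩ := exists_dotProduct_riccatiMap_eq (A := A) (B := B) (C := C) hR
    (X := X) (t := t) ⟨hX, .inl ht⟩ v
  rw [h, stepCost] at hu
  have h1 := dotProduct_nonneg hX (A *ᵥ v + B *ᵥ u)
  have h2 := mul_nonneg ht.le (dotProduct_nonneg (nonneg_iff_posSemidef.2 hR.posSemidef) u)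
  have h3 := mul_nonneg ht.le (real_dotProduct_self_nonneg (C *ᵥ v))
  have h2' : t * (u ⬝ᵥ R *ᵥ u) = 0 := by linarith
  have h3' : t * (C *ᵥ v ⬝ᵥ C *ᵥ v) = 0 := by linarith
  have hu0 : u = 0 := by
    by_contra hne
    exact (mul_pos ht (hR.dotProduct_mulVec_pos hne)).ne' h2'
  subst hu0
  rw [mulVec_zero, add_zero] at h1 hu
  exact ⟨by linarith, dotProduct_self_eq_zero.1 ((mul_eq_zero.1 h3').resolve_left ht.ne')⟩

theorem homF_ne_zero (hn : 0 < n) (hAC : IsObservable A C) (hR : R.PosDef) {α : ℝ} (hα : 0 < α)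
    {X : Matrix (Fin n) (Fin n) ℝ} (hX : 0 ≤ X) (hX0 : X ≠ 0) : homF A B C R α X ≠ 0 := by
  intro h
  have h1 := smul_le_riccatiMap (A := A) (B := B) (C := C) hR (admissible_trace hα hX)
  rw [← homF_eq, h] at h1
  have h2 := mul_pos hα (trace_pos_of_ne_zero hX hX0)
  have h3 := le_antisymm h1 (smul_nonneg h2.le (transpose_mul_self_nonneg C))
  exact (smul_ne_zero h2.ne' (hAC.transpose_mul_self_ne_zero hn)) h3

theorem iterate_homF_ne_zero (hn : 0 < n) (hAC : IsObservable A C) (hR : R.PosDef) {α : ℝ}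
    (hα : 0 < α) {X : Matrix (Fin n) (Fin n) ℝ} (hX : 0 ≤ X) (hX0 : X ≠ 0) (k : ℕ) :
    (homF A B C R α)^[k] X ≠ 0 := by
  induction k with
  | zero => exact hX0
  | succ k ih =>
    rw [Function.iterate_succ_apply']
    exact homF_ne_zero hn hAC hR hα (((isPsdSuperlinear_homF hR hα).iterate k).nonneg hX) ih

/-- A state of zero cost over `n` steps moves uncontrolled and unseen by `C` at times `0, …, n - 1`,
so observability makes it `0`. -/
theorem posDef_iterate_homF (hn : 0 < n) (hAC : IsObservable A C) (hR : R.PosDef) {α : ℝ}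
    (hα : 0 < α) {X : Matrix (Fin n) (Fin n) ℝ} (hX : 0 ≤ X) (hX0 : X ≠ 0) :
    ((homF A B C R α)^[n] X).PosDef := by
  have hF := isPsdSuperlinear_homF (A := A) (B := B) (C := C) hR hα
  have key : ∀ k (v : Fin n → ℝ), v ⬝ᵥ (homF A B C R α)^[k] X *ᵥ v = 0 →
      ∀ j < k, C *ᵥ (A ^ j *ᵥ v) = 0 := by
    intro k
    induction k with
    | zero => simp
    | succ k ih =>
      intro v hv j hj
      rw [Function.iterate_succ_apply', homF_eq] at hv
      have hY := (hF.iterate k).nonneg hX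
      obtain ⟨h1, h2⟩ := of_dotProduct_riccatiMap_eq_zero hR (mul_pos hα
        (trace_pos_of_ne_zero hY (iterate_homF_ne_zero hn hAC hR hα hX hX0 k))) hY hv
      cases j with
      | zero => simpa using h2
      | succ j =>
        have := ih _ h1 j (by omega)
        rw [pow_succ, ← mulVec_mulVec]
        exact this
  have hY := (hF.iterate n).nonneg hX
  refine .of_dotProduct_mulVec_pos (isHermitian_of_nonneg hY) fun v hv => ?_
  refine lt_of_le_of_ne (dotProduct_nonneg hY v) fun h => hv (hAC.eq_zero (key n v h.symm))

/-! Existence of a solution of the Riccati equation -/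

/-- The weight is fixed here, so the map is not homogeneous and `IsPsdSuperlinear.mono` does not
apply; the optimal control for `Y` is tried for `X`. -/
theorem riccatiMap_mono (hR : R.PosDef) {t : ℝ} (ht : 0 < t) {X Y : Matrix (Fin n) (Fin n) ℝ}
    (hX : 0 ≤ X) (h : X ≤ Y) : riccatiMap A B C R t X ≤ riccatiMap A B C R t Y := by
  have hX' : Admissible t X := ⟨hX, .inl ht⟩
  have hY' : Admissible t Y := ⟨hX.trans h, .inl ht⟩
  refine (le_iff_dotProduct (isHermitian_of_nonneg (riccatiMap_nonneg hR hX'))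
    (isHermitian_of_nonneg (riccatiMap_nonneg hR hY'))).2 fun v => ?_
  obtain ⟨u, hu⟩ := exists_dotProduct_riccatiMap_eq (A := A) (B := B) (C := C) hR hY' v
  rw [hu]
  refine (dotProduct_riccatiMap_le hR hX' v u).trans ?_
  have := dotProduct_le_of_le h (A *ᵥ v + B *ᵥ u)
  simp only [stepCost]
  linarith

theorem IsControllable.exists_eq_sum (h : IsControllable A B) (x : Fin n → ℝ) :
    ∃ w : ℕ → Fin p → ℝ, x = ∑ k ∈ Finset.range n, A ^ k *ᵥ (B *ᵥ w k) := by
  have h2 : Module.finrank ℝ (controllabilityMatrix A B).mulVecLin.range = n := h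
  have h1 : (controllabilityMatrix A B).mulVecLin.range = ⊤ :=
    Submodule.eq_top_of_finrank_eq (by rw [h2, Module.finrank_fin_fun])
  obtain ⟨y, rfl⟩ := LinearMap.range_eq_top.1 h1 x
  refine ⟨fun k j => if hk : k < n then y (⟨k, hk⟩, j) else 0, ?_⟩
  rw [Finset.sum_range]
  ext i
  simp [controllabilityMatrix, mulVec, dotProduct, Fintype.sum_prod_type, Finset.sum_apply,
    mulVec_mulVec]

/-- Value iteration from `0` is bounded at each state. -/
theorem exists_dotProduct_iterate_le (hAB : IsControllable A B) (hR : R.PosDef)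
    (v : Fin n → ℝ) : ∃ c : ℝ, ∀ k, v ⬝ᵥ (riccatiMap A B C R 1)^[k] 0 *ᵥ v ≤ c := by
  have hadm : ∀ k, Admissible 1 ((riccatiMap A B C R 1)^[k] 0) := by
    intro k
    induction k with
    | zero => exact ⟨le_rfl, .inl one_pos⟩
    | succ k ih =>
      rw [Function.iterate_succ_apply']
      exact ⟨riccatiMap_nonneg hR ih, .inl one_pos⟩
  -- A bound at the successor state, plus the stage cost, is a bound at `v`.
  have hstep : ∀ (v : Fin n → ℝ) (u : Fin p → ℝ),
      (∃ c : ℝ, ∀ k, (A *ᵥ v + B *ᵥ u) ⬝ᵥ (riccatiMap A B C R 1)^[k] 0 *ᵥ (A *ᵥ v + B *ᵥ u) ≤ c) →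
      ∃ c : ℝ, ∀ k, v ⬝ᵥ (riccatiMap A B C R 1)^[k] 0 *ᵥ v ≤ c := by
    rintro v u ⟨c, hc⟩
    have hc0 : 0 ≤ c := by simpa using hc 0
    have h1 := dotProduct_nonneg (nonneg_iff_posSemidef.2 hR.posSemidef) u
    have h2 := real_dotProduct_self_nonneg (C *ᵥ v)
    refine ⟨c + 1 * (u ⬝ᵥ R *ᵥ u) + 1 * (C *ᵥ v ⬝ᵥ C *ᵥ v), fun k => ?_⟩
    cases k with
    | zero =>
      simp only [Function.iterate_zero, id_eq, zero_mulVec, dotProduct_zero]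
      positivity
    | succ k =>
      rw [Function.iterate_succ_apply']
      refine (dotProduct_riccatiMap_le hR (hadm k) v u).trans ?_
      rw [stepCost]
      linarith [hc k]
  have key : ∀ j (v : Fin n → ℝ) (w : ℕ → Fin p → ℝ),
      A ^ j *ᵥ v = ∑ k ∈ Finset.range j, A ^ k *ᵥ (B *ᵥ w k) →
      ∃ c : ℝ, ∀ k, v ⬝ᵥ (riccatiMap A B C R 1)^[k] 0 *ᵥ v ≤ c := by
    intro j
    induction j with
    | zero =>
      intro v w h
      have hv : v = 0 := by simpa using h
      exact ⟨0, fun k => by simp [hv]⟩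
    | succ j ih =>
      intro v w h
      -- The control applied first is multiplied by the highest power of `A`, so `-w j` cancels the
      -- top term and leaves `j` steps to the origin.
      refine hstep v (-w j) (ih _ w ?_)
      rw [Finset.sum_range_succ, pow_succ, ← mulVec_mulVec] at h
      rw [mulVec_neg, mulVec_add, mulVec_neg, h, add_neg_cancel_right]
  obtain ⟨w, hw⟩ := hAB.exists_eq_sum (A ^ n *ᵥ v)
  exact key n v w hw

theorem continuousAt_riccatiMap (hR : R.PosDef) {t : ℝ} (ht : 0 < t)
    {X : Matrix (Fin n) (Fin n) ℝ} (hX : 0 ≤ X) : ContinuousAt (riccatiMap A B C R t) X := by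
  have hdet : (t • R + Bᵀ * X * B).det ≠ 0 :=
    ((isUnit_iff_isUnit_det _).1 (posDef_control ht hR hX).isUnit).ne_zero
  have h1 : ContinuousAt (fun M : Matrix (Fin p) (Fin p) ℝ => M⁻¹) (t • R + Bᵀ * X * B) :=
    continuousAt_matrix_inv _ (by
      rw [Ring.inverse_eq_inv']
      exact continuousAt_inv₀ hdet)
  have h2 : ContinuousAt (fun X : Matrix (Fin n) (Fin n) ℝ => t • R + Bᵀ * X * B) X := by fun_prop
  have h3 : ContinuousAt (fun X : Matrix (Fin n) (Fin n) ℝ => (t • R + Bᵀ * X * B)⁻¹) X :=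
    ContinuousAt.comp (g := fun M : Matrix (Fin p) (Fin p) ℝ => M⁻¹) h1 h2
  unfold riccatiMap
  fun_prop

theorem apply_eq_polarization {X : Matrix (Fin n) (Fin n) ℝ} (hX : X.IsHermitian) (i j : Fin n) :
    X i j = ((Pi.single i 1 + Pi.single j 1) ⬝ᵥ X *ᵥ (Pi.single i 1 + Pi.single j 1) -
      Pi.single i 1 ⬝ᵥ X *ᵥ Pi.single i 1 - Pi.single j 1 ⬝ᵥ X *ᵥ Pi.single j 1) / 2 := by
  have hs : X j i = X i j := by simpa using hX.apply i j
  simp [mulVec_add, add_dotProduct, hs]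
  ring

/-- A bounded increasing sequence of positive semidefinite matrices converges. -/
theorem exists_tendsto_of_monotone {X : ℕ → Matrix (Fin n) (Fin n) ℝ} (h0 : ∀ k, 0 ≤ X k)
    (hX : Monotone X) (hb : ∀ v : Fin n → ℝ, ∃ c : ℝ, ∀ k, v ⬝ᵥ X k *ᵥ v ≤ c) :
    ∃ P, 0 ≤ P ∧ Tendsto X atTop (𝓝 P) := by
  have hq : ∀ v : Fin n → ℝ, ∃ l : ℝ, Tendsto (fun k => v ⬝ᵥ X k *ᵥ v) atTop (𝓝 l) := by
    intro v
    obtain ⟨c, hc⟩ := hb v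
    exact ⟨_, tendsto_atTop_ciSup (fun i j hij => dotProduct_le_of_le (hX hij) v)
      ⟨c, by rintro _ ⟨k, rfl⟩; exact hc k⟩⟩
  choose l hl using hq
  let P : Matrix (Fin n) (Fin n) ℝ := Matrix.of fun i j =>
    (l (Pi.single i 1 + Pi.single j 1) - l (Pi.single i 1) - l (Pi.single j 1)) / 2
  have hP : Tendsto X atTop (𝓝 P) := by
    refine tendsto_pi_nhds.2 fun i => tendsto_pi_nhds.2 fun j => ?_
    simp_rw [fun k => apply_eq_polarization (isHermitian_of_nonneg (h0 k)) i j]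
    exact (((hl _).sub (hl _)).sub (hl _)).div_const 2
  refine ⟨P, ?_, hP⟩
  have hPh : P.IsHermitian := by
    ext i j
    simp only [P, conjTranspose_apply, of_apply, star_trivial]
    rw [add_comm (Pi.single j _), sub_right_comm]
  refine (le_iff_dotProduct isHermitian_zero hPh).2 fun v => ?_
  have : Tendsto (fun k => v ⬝ᵥ X k *ᵥ v) atTop (𝓝 (v ⬝ᵥ P *ᵥ v)) :=
    ((by fun_prop : Continuous fun X : Matrix (Fin n) (Fin n) ℝ => v ⬝ᵥ X *ᵥ v).tendsto P).comp hP
  simpa using ge_of_tendsto' this fun k => dotProduct_nonneg (h0 k) v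

theorem exists_riccatiMap_eq_self (hAB : IsControllable A B) (hR : R.PosDef) :
    ∃ P, 0 ≤ P ∧ riccatiMap A B C R 1 P = P := by
  set T := riccatiMap A B C R 1
  have h0 : ∀ k, 0 ≤ T^[k] 0 := by
    intro k
    induction k with
    | zero => exact le_rfl
    | succ k ih =>
      rw [Function.iterate_succ_apply']
      exact riccatiMap_nonneg hR ⟨ih, .inl one_pos⟩
  have hmono : Monotone fun k => T^[k] 0 := by
    refine monotone_nat_of_le_succ fun k => ?_
    induction k with
    | zero => exact h0 1
    | succ k ih =>
      rw [Function.iterate_succ_apply', Function.iterate_succ_apply']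
      exact riccatiMap_mono hR one_pos (h0 k) ih
  obtain ⟨P, hP, hlim⟩ := exists_tendsto_of_monotone h0 hmono
    (exists_dotProduct_iterate_le hAB hR)
  exact ⟨P, hP, isFixedPt_of_tendsto_iterate hlim (continuousAt_riccatiMap hR one_pos hP)⟩

end Positivity

end PosRiccati

namespace PosRiccati

/-! ### The critical weight and the main theorem -/

section Main

open Matrix
open scoped MatrixOrder

namespace IsPsdSuperlinear

variable {n : ℕ} {F : Matrix (Fin n) (Fin n) ℝ → Matrix (Fin n) (Fin n) ℝ}
  {P Z : Matrix (Fin n) (Fin n) ℝ}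

/-- The defect `Z` may be singular; transported by `F^[k]` it can become definite, which turns a
weak decrease of `P` into a strict one. -/
theorem iterate_add_iterate_le (hF : IsPsdSuperlinear F) (hP : 0 ≤ P) (hZ : 0 ≤ Z)
    (h : F P + Z ≤ P) (k : ℕ) : F^[k + 1] P + F^[k] Z ≤ P := by
  induction k with
  | zero => exact h
  | succ k ih =>
    rw [Function.iterate_succ_apply' F (k + 1), Function.iterate_succ_apply' F k Z]
    have h1 := (hF.iterate (k + 1)).nonneg hP
    have h2 := (hF.iterate k).nonneg hZ
    exact (hF.add_le h1 h2).trans ((hF.mono (add_nonneg h1 h2) ih).trans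
      ((le_add_of_nonneg_right hZ).trans h))

theorem add_iterate_le_iterate (hF : IsPsdSuperlinear F) (hP : 0 ≤ P) (hZ : 0 ≤ Z)
    (h : P + Z ≤ F P) (k : ℕ) : P + F^[k] Z ≤ F^[k + 1] P := by
  induction k with
  | zero => exact h
  | succ k ih =>
    rw [Function.iterate_succ_apply' F (k + 1), Function.iterate_succ_apply' F k Z]
    have h2 := (hF.iterate k).nonneg hZ
    exact (add_le_add_left ((le_add_of_nonneg_right hZ).trans h) _).trans
      ((hF.add_le hP h2).trans (hF.mono (add_nonneg hP h2) ih))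

end IsPsdSuperlinear

variable {n m p : ℕ} {A : Matrix (Fin n) (Fin n) ℝ} {B : Matrix (Fin n) (Fin p) ℝ}
  {C : Matrix (Fin m) (Fin n) ℝ} {R : Matrix (Fin p) (Fin p) ℝ}
  {P Y : Matrix (Fin n) (Fin n) ℝ} {α : ℝ}

/-- One step gives at least `α tr(Z) Cᵀ C`, and `n` more make this fixed direction definite; hence
`n + 1` steps and a `δ` independent of `Z`. -/
theorem exists_smul_le_iterate_homF (hn : 0 < n) (hAC : IsObservable A C) (hR : R.PosDef)
    (hα : 0 < α) (hP : P.PosDef) :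
    ∃ δ : ℝ, 0 < δ ∧ ∀ Z, 0 ≤ Z → (δ * Z.trace) • P ≤ (homF A B C R α)^[n + 1] Z := by
  have hF := isPsdSuperlinear_homF (A := A) (B := B) (C := C) hR hα
  have hC := smul_nonneg hα.le (transpose_mul_self_nonneg C)
  have hC0 := smul_ne_zero hα.ne' (hAC.transpose_mul_self_ne_zero hn)
  obtain ⟨δ, hδ, h⟩ := exists_smul_le
    (posDef_iterate_homF (B := B) hn hAC hR hα hC hC0) hP.1
  refine ⟨δ, hδ, fun Z hZ => ?_⟩
  have ht : 0 ≤ Z.trace := (nonneg_iff_posSemidef.1 hZ).trace_nonneg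
  have h1 := smul_le_riccatiMap (A := A) (B := B) (C := C) hR (admissible_trace hα hZ)
  rw [← homF_eq, mul_comm, ← smul_smul] at h1
  have h2 := (hF.iterate n).mono (smul_nonneg ht hC) h1
  rw [(hF.iterate n).map_smul ht hC, ← Function.iterate_succ_apply] at h2
  refine le_trans ?_ h2
  rw [mul_comm, ← smul_smul]
  exact smul_le_smul_of_nonneg_left h ht

theorem exists_eventually_le_iterate_homF (hn : 0 < n) (hAC : IsObservable A C) (hR : R.PosDef)
    (hα : 0 < α) (hP : P.PosDef) (hFP : homF A B C R α P = P) (hY : 0 ≤ Y) (hY0 : Y ≠ 0) :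
    ∃ c : ℝ, 0 < c ∧ ∀ ε > 0, ∀ᶠ k in atTop,
      (c - ε) • P ≤ (homF A B C R α)^[k] Y ∧ (homF A B C R α)^[k] Y ≤ (c + ε) • P := by
  obtain ⟨δ, hδ, h⟩ := exists_smul_le_iterate_homF (B := B) hn hAC hR hα hP
  exact (isPsdSuperlinear_homF hR hα).exists_eventually_le hP hFP hδ h hY hY0

theorem eq_smul_of_homF_eq (hn : 0 < n) (hAC : IsObservable A C) (hR : R.PosDef) (hα : 0 < α)
    (hP : P.PosDef) (hFP : homF A B C R α P = P) (hY : 0 ≤ Y) (hY0 : Y ≠ 0)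
    (hFY : homF A B C R α Y = Y) : ∃ c : ℝ, 0 < c ∧ Y = c • P := by
  obtain ⟨c, hc, h⟩ := exists_eventually_le_iterate_homF hn hAC hR hα hP hFP hY hY0
  refine ⟨c, hc, eq_smul_of_forall_le hP.1 (isHermitian_of_nonneg hY) fun ε hε => ?_⟩
  obtain ⟨k, hk⟩ := (h ε hε).exists
  rwa [Function.iterate_fixed hFY] at hk

theorem homF_inv_trace (hP : 0 < P.trace) (h : riccatiMap A B C R 1 P = P) :
    homF A B C R P.trace⁻¹ P = P := by
  rw [homF_eq, inv_mul_cancel₀ hP.ne', h]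

theorem eq_inv_trace_of_psdSpectralRadius_eq_one (hn : 0 < n) (hAC : IsObservable A C)
    (hR : R.PosDef) (hα : 0 < α) (hP : P.PosDef) (h : riccatiMap A B C R 1 P = P)
    (hρ : psdSpectralRadius (homF A B C R α) = 1) : α = P.trace⁻¹ := by
  have : Nonempty (Fin n) := ⟨⟨0, hn⟩⟩
  have hP' : 0 ≤ P := nonneg_iff_posSemidef.2 hP.posSemidef
  have hτ : 0 < P.trace := hP.trace_pos
  have hP0 : P ≠ 0 := by
    rintro rfl
    simp at hτ
  have hF := isPsdSuperlinear_homF (A := A) (B := B) (C := C) hR hα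
  have hC := transpose_mul_self_nonneg C
  have hadm : ∀ {ε : ℝ}, 0 < ε → Admissible ε (0 : Matrix (Fin n) (Fin n) ℝ) :=
    fun hε => ⟨le_rfl, .inl hε⟩
  obtain ⟨δ, hδ, hδP⟩ := exists_smul_le
    (posDef_iterate_homF (B := B) hn hAC hR hα hC (hAC.transpose_mul_self_ne_zero hn)) hP.1
  rcases lt_trichotomy (α * P.trace) 1 with hlt | heq | hgt
  · exfalso
    set ε := 1 - α * P.trace with hε
    have hε0 : 0 < ε := sub_pos.2 hlt
    -- Split the weight `1 = α tr P + ε`, giving the part `ε` terminal cost `0`; that part still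
    -- contributes `ε Cᵀ C`.
    have h1 := riccatiMap_add_le (A := A) (B := B) (C := C) hR (admissible_trace hα hP')
      (hadm hε0)
    rw [← homF_eq, hε, add_sub_cancel, add_zero, h, ← hε] at h1
    have h2 : homF A B C R α P + ε • (Cᵀ * C) ≤ P :=
      (add_le_add_right (smul_le_riccatiMap hR (hadm hε0)) _).trans h1
    have h3 := hF.iterate_add_iterate_le hP' (smul_nonneg hε0.le hC) h2 n
    rw [(hF.iterate n).map_smul hε0.le hC] at h3
    have h4 : (homF A B C R α)^[n + 1] P ≤ (1 - ε * δ) • P := by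
      rw [sub_smul, one_smul, ← smul_smul]
      exact le_sub_iff_add_le.2
        ((add_le_add_right (smul_le_smul_of_nonneg_left hδP hε0.le) _).trans h3)
    -- The maximum with `1 / 2` keeps the rate positive.
    have h5 := hF.psdSpectralRadius_lt_one hP
      ((le_add_of_nonneg_right (smul_nonneg hε0.le hC)).trans h2) n.succ_ne_zero
      (r := max (1 - ε * δ) (1 / 2)) (by positivity)
      (max_lt (sub_lt_self _ (mul_pos hε0 hδ)) (by norm_num))
      (h4.trans (smul_le_smul_of_nonneg_right (le_max_left _ _) hP'))
    exact h5.ne hρ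
  · exact eq_inv_of_mul_eq_one_left heq
  · exfalso
    set ε := α * P.trace - 1 with hε
    have hε0 : 0 < ε := sub_pos.2 hgt
    have h1 := riccatiMap_add_le (A := A) (B := B) (C := C) hR
      (show Admissible 1 P from ⟨hP', .inl one_pos⟩) (hadm hε0)
    rw [hε, add_sub_cancel, add_zero, h, ← hε, ← homF_eq] at h1
    have h2 : P + ε • (Cᵀ * C) ≤ homF A B C R α P :=
      (add_le_add_right (smul_le_riccatiMap hR (hadm hε0)) _).trans h1
    have h3 := hF.add_iterate_le_iterate hP' (smul_nonneg hε0.le hC) h2 n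
    rw [(hF.iterate n).map_smul hε0.le hC] at h3
    have h4 : (1 + ε * δ) • P ≤ (homF A B C R α)^[n + 1] P := by
      rw [add_smul, one_smul, ← smul_smul]
      exact (add_le_add_right (smul_le_smul_of_nonneg_left hδP hε0.le) _).trans h3
    have h5 := hF.one_lt_psdSpectralRadius hP' hP0
      ((le_add_of_nonneg_right (smul_nonneg hε0.le hC)).trans h2) n.succ_ne_zero
      (lt_add_of_pos_right 1 (mul_pos hε0 hδ)) h4
    exact h5.ne' hρ

end Main

end PosRiccati

theorem fact3 {n m p : ℕ} (hn : 0 < n)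
    (A : Matrix (Fin n) (Fin n) ℝ) (B : Matrix (Fin n) (Fin p) ℝ)
    (C : Matrix (Fin m) (Fin n) ℝ) (R : Matrix (Fin p) (Fin p) ℝ)
    (hR : R.PosDef)
    (hAB : PosRiccati.IsControllable A B) (hAC : PosRiccati.IsObservable A C) :
    ∃ P : Matrix (Fin n) (Fin n) ℝ,
      -- `P` is the unique positive definite solution of the Riccati equation
      (P.PosDef ∧ PosRiccati.SolvesDARE A B C R P ∧
        ∀ Q : Matrix (Fin n) (Fin n) ℝ, Q.PosDef → PosRiccati.SolvesDARE A B C R Q → Q = P) ∧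
      -- `α > 0` can be tuned so that the cone spectral radius is `1`
      (∃ α : ℝ, 0 < α ∧ PosRiccati.psdSpectralRadius (PosRiccati.homF A B C R α) = 1) ∧
      -- for such `α`, `P` is the normalized Perron–Frobenius eigenvector, and the iterates converge
      ∀ α : ℝ, 0 < α → PosRiccati.psdSpectralRadius (PosRiccati.homF A B C R α) = 1 →
        (∃ X : Matrix (Fin n) (Fin n) ℝ, X.PosDef ∧
          PosRiccati.IsPerronFrobeniusEigenvector (PosRiccati.homF A B C R α) X ∧
          (∀ Y : Matrix (Fin n) (Fin n) ℝ,
            PosRiccati.IsPerronFrobeniusEigenvector (PosRiccati.homF A B C R α) Y →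
              ∃ c : ℝ, 0 < c ∧ Y = c • X) ∧
          P = (α * X.trace)⁻¹ • X) ∧
        ∀ X : ℕ → Matrix (Fin n) (Fin n) ℝ, (X 0).PosSemidef → X 0 ≠ 0 →
          (∀ k, X (k + 1) = PosRiccati.homF A B C R α (X k)) →
          Tendsto (fun k => PosRiccati.hilbertMetric (PosRiccati.psdCone n) (X k) P) atTop (𝓝 0) := by
  open scoped MatrixOrder in
  open PosRiccati Matrix in
  have : Nonempty (Fin n) := ⟨⟨0, hn⟩⟩
  have hpos : ∀ {Q : Matrix (Fin n) (Fin n) ℝ}, 0 ≤ Q → riccatiMap A B C R 1 Q = Q →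
      Q ≠ 0 := by
    rintro Q hQ hric rfl
    have h1 := smul_le_riccatiMap (A := A) (B := B) (C := C) hR (t := 1) ⟨hQ, .inl one_pos⟩
    rw [hric, one_smul] at h1
    exact hAC.transpose_mul_self_ne_zero hn (le_antisymm h1 (transpose_mul_self_nonneg C))
  have hfix : ∀ {Q : Matrix (Fin n) (Fin n) ℝ}, 0 ≤ Q → riccatiMap A B C R 1 Q = Q →
      0 < Q.trace⁻¹ ∧ homF A B C R Q.trace⁻¹ Q = Q := fun hQ hric =>
    have ht := trace_pos_of_ne_zero hQ (hpos hQ hric)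
    ⟨inv_pos.2 ht, homF_inv_trace ht hric⟩
  have hrad : ∀ {Q : Matrix (Fin n) (Fin n) ℝ}, Q.PosDef → riccatiMap A B C R 1 Q = Q →
      psdSpectralRadius (homF A B C R Q.trace⁻¹) = 1 := fun {Q} hQ hric => by
    have hQ' := nonneg_iff_posSemidef.2 hQ.posSemidef
    exact (isPsdSuperlinear_homF hR (hfix hQ' hric).1).psdSpectralRadius_eq_one hQ
      (hpos hQ' hric) (hfix hQ' hric).2
  obtain ⟨P, hP', hric⟩ := exists_riccatiMap_eq_self (A := A) (C := C) hAB hR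
  obtain ⟨hα₀, hFP⟩ := hfix hP' hric
  have hP0 := hpos hP' hric
  have hP : P.PosDef := by
    have := posDef_iterate_homF (B := B) hn hAC hR hα₀ hP' hP0
    rwa [Function.iterate_fixed hFP] at this
  refine ⟨P, ⟨hP, solvesDARE_iff.2 hric, fun Q hQ hQric => ?_⟩, ⟨_, hα₀, hrad hP hric⟩,
    fun α hα hρ => ?_⟩
  · rw [solvesDARE_iff] at hQric
    have hQ' := nonneg_iff_posSemidef.2 hQ.posSemidef
    obtain ⟨hβ, hFQ⟩ := hfix hQ' hQric
    -- Radius `1` at `1 / tr Q` forces `tr Q = tr P`; then `Q` and `P` are fixed by the same map, so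
    -- `Q = c P`, and the traces give `c = 1`.
    have htr := eq_inv_trace_of_psdSpectralRadius_eq_one hn hAC hR hβ hP hric (hrad hQ hQric)
    rw [htr] at hFQ
    obtain ⟨c, -, rfl⟩ := eq_smul_of_homF_eq hn hAC hR hα₀ hP hFP hQ' (hpos hQ' hQric) hFQ
    rw [_root_.inv_inj, trace_smul, smul_eq_mul] at htr
    rw [(mul_eq_right₀ (inv_pos.1 hα₀).ne').1 htr, one_smul]
  · obtain rfl := eq_inv_trace_of_psdSpectralRadius_eq_one hn hAC hR hα hP hric hρ
    -- Now `α tr P = 1`, so `P` itself serves as the eigenvector.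
    refine ⟨⟨P, hP, ⟨hP.posSemidef, hP0, ?_, ?_⟩, ?_, ?_⟩, fun X hX hX0 hXs => ?_⟩
    · simp [hρ]
    · simp [hρ, hFP]
    · rintro Y ⟨hY, hY0, -, hFY⟩
      rw [hρ, ENNReal.toReal_one, one_smul] at hFY
      exact eq_smul_of_homF_eq hn hAC hR hα hP hFP (nonneg_iff_posSemidef.2 hY) hY0 hFY
    · rw [inv_mul_cancel₀ (inv_pos.1 hα₀).ne', inv_one, one_smul]
    · obtain ⟨c, hc, h⟩ := exists_eventually_le_iterate_homF hn hAC hR hα hP hFP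
        (nonneg_iff_posSemidef.2 hX) hX0
      have hXk : X = fun k => (homF A B C R P.trace⁻¹)^[k] (X 0) := by
        funext k
        induction k with
        | zero => rfl
        | succ k ih => rw [hXs, ih, Function.iterate_succ_apply']
      rw [hXk]
      exact tendsto_hilbertMetric hP' hP0 hc h
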